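/- Let $k$ be an algebraically closed field of characteristic $\neq 2$. Algebras are associative $k$-algebras, not necessarily unital; an algebra is abelian if all its products are $0$, and metabelian if it is an extension of an abelian algebra by an abelian algebra, i.e. if there is an exact sequence of algebra maps $0\to V_0\to A\to P_0\to 0$ with $V_0$, $P_0$ abelian. The derived algebra $A'$ is the subspace spanned by all products $xy$. For a matrix $\theta\in M_n(k)$ let $k^{n+1}_\theta$ be the $(n+1)$-dimensional algebra with basis $E,F_1,\dots,F_n$ and $F_iF_j=\theta_{ij}E$, all other products of basis elements being $0$. Matrices $\theta,\theta'\in M_n(k)$ are congruent if $\theta=C^{T}\theta' C$ for some invertible $C$. In the tables below undefined products of basis elements are $0$. (1) An algebra is $3$-dimensional and metabelian with $\dim_k A'=1$ if and only if it is isomorphic to one of the following, for some $a,b\in k$: - $k^3_{a,b}$: $F_1F_1=E,\ F_1F_2=aE,\ F_2F_1=bE$; - $k^3_{-1}$: $F_1F_2=-F_2F_1=E$. No $k^3_{a,b}$ is isomorphic to $k^3_{-1}$. (2) An algebra is $4$-dimensional and metabelian with $\dim_k A'=1$ if and only if it is isomorphic to one of the following, for some $a,b\in k$: - $k^{4,1}_{a,b}$: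 $F_1F_1=F_2F_2=E,\ F_2F_3=aE,\ F_3F_2=bE$; - $k^{4,2}_{a,b}$: $F_2F_2=E,\ F_2F_3=aE,\ F_3F_2=bE$; - $k^{4,3}$: $F_1F_1=F_2F_3=-F_3F_2=E$; - $k^{4,4}$: $F_2F_3=-F_3F_2=E$; - $k^{4,5}$: $F_1F_2=F_2F_3=-F_3F_2=E$; - $k^{4,6}$: $F_1F_1=F_1F_2=F_2F_2=F_2F_3=F_3F_2=E$. Algebras from two different families of this list are never isomorphic, except that $k^{4,1}_{a,b}\cong k^{4,2}_{c,d}$ holds precisely when $a=b=0$ and $c=d\neq 0$. (3) For all $n$ and $\theta,\theta'\in M_n(k)$, $k^{n+1}_\theta\cong k^{n+1}_{\theta'}$ if and only if $\theta$ and $\theta'$ are congruent. A $2\times 2$ matrix is nonzero if and only if it is congruent to $$\begin{pmatrix}1&a\\ b&0\end{pmatrix}\ (\text{some } a,b\in k)\quad\text{or}\quad \begin{pmatrix}0&1\\-1&0\end{pmatrix},$$ and a $3\times 3$ matrix is nonzero if and only if it is congruent, for some $a,b\in k$, to one of $$\begin{pmatrix}1&0&0\\0&1&a\\0&b&0\end{pmatrix},\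 \begin{pmatrix}0&0&0\\0&1&a\\0&b&0\end{pmatrix},\ \begin{pmatrix}1&0&0\\0&0&1\\0&-1&0\end{pmatrix},\ \begin{pmatrix}0&0&0\\0&0&1\\0&-1&0\end{pmatrix},\ \begin{pmatrix}0&1&0\\0&0&1\\0&-1&0\end{pmatrix},\ \begin{pmatrix}1&1&0\\0&1&1\\0&1&0\end{pmatrix}.$$ The algebras listed in (1) and (2) are the $k^{n+1}_\theta$ of these matrices, in the same order. -/

import Mathlib

open scoped Matrix

namespace Metab

/-- The abelian algebra `V₀` : the vector space `V` with the trivial multiplication `x * y = 0`. -/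
def ZeroAlg (V : Type*) : Type _ := V

namespace ZeroAlg

variable {V : Type*} [AddCommGroup V]

instance : AddCommGroup (ZeroAlg V) := inferInstanceAs (AddCommGroup V)

instance : NonUnitalRing (ZeroAlg V) :=
  { (inferInstance : AddCommGroup (ZeroAlg V)) with
    mul := fun _ _ => 0
    left_distrib := fun _ _ _ => (add_zero (0 : ZeroAlg V)).symm
    right_distrib := fun _ _ _ => (add_zero (0 : ZeroAlg V)).symm
    zero_mul := fun _ => rfl
    mul_zero := fun _ => rfl
    mul_assoc := fun _ _ _ => rfl }

instance {k : Type*} [Field k] [Module k V] : Module k (ZeroAlg V) :=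
  inferInstanceAs (Module k V)

theorem mul_eq_zero' (x y : ZeroAlg V) : x * y = 0 := rfl

end ZeroAlg

/-- The algebra `A` is metabelian: there are vector spaces `V`, `P` and an exact sequence of
algebra maps `0 → V₀ → A → P₀ → 0`. -/
def IsMetabelian.{u, v} (k : Type u) [Field k] (A : Type v) [NonUnitalRing A] [Module k A] : Prop :=
  ∃ (V P : Type v) (_ : AddCommGroup V) (_ : AddCommGroup P) (_ : Module k V) (_ : Module k P)
    (i : ZeroAlg V →ₙₐ[k] A) (π : A →ₙₐ[k] ZeroAlg P),
    Function.Injective i ∧ Function.Exact i π ∧ Function.Surjective π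

/-- The derived algebra `A'`: the subspace spanned by all products `x * y`. -/
def derivedAlg (k : Type*) [Field k] (A : Type*) [NonUnitalRing A] [Module k A] :
    Submodule k A :=
  Submodule.span k {z : A | ∃ x y : A, z = x * y}

/-- Isomorphism of (associative, not necessarily unital) `k`-algebras. -/
def AlgIso (k : Type*) [Field k] (A B : Type*) [NonUnitalRing A] [Module k A]
    [NonUnitalRing B] [Module k B] : Prop :=
  ∃ f : A ≃ₗ[k] B, ∀ x y : A, f (x * y) = f x * f y

/-- Congruence of square matrices, that is, isometry of the corresponding bilinear forms. -/
def Congruent {k : Type*} [Field k] {n : ℕ} (M N : Matrix (Fin n) (Fin n) k) : Prop :=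
  ∃ C : GL (Fin n) k, M = (C : Matrix (Fin n) (Fin n) k)ᵀ * N * (C : Matrix (Fin n) (Fin n) k)

/-- For an `n × n` matrix `θ`, the `(n + 1)`-dimensional algebra `k ^ n ⋆_θ k` on `k ^ n × k` with
`(p, x) * (q, y) = (0, θ (p, q))`, where `θ (p, q) = pᵀ θ q`. -/
def FormAlg {k : Type*} [Field k] {n : ℕ} (_θ : Matrix (Fin n) (Fin n) k) : Type _ :=
  (Fin n → k) × k

namespace FormAlg

variable {k : Type*} [Field k] {n : ℕ} {θ : Matrix (Fin n) (Fin n) k}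

instance : AddCommGroup (FormAlg θ) := inferInstanceAs (AddCommGroup ((Fin n → k) × k))

instance : Module k (FormAlg θ) := inferInstanceAs (Module k ((Fin n → k) × k))

/-- The element `(p, x)`. -/
def mk (θ : Matrix (Fin n) (Fin n) k) (p : Fin n → k) (x : k) : FormAlg θ := (p, x)

/-- The multiplication `(p, x) * (q, y) = (0, pᵀ θ q)`. -/
instance : Mul (FormAlg θ) := ⟨fun u v => mk θ 0 (u.1 ⬝ᵥ θ *ᵥ v.1)⟩

theorem mul_def (u v : FormAlg θ) : u * v = mk θ 0 (u.1 ⬝ᵥ θ *ᵥ v.1) := rfl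

instance : NonUnitalRing (FormAlg θ) :=
  { (inferInstance : AddCommGroup (FormAlg θ)), (inferInstance : Mul (FormAlg θ)) with
    left_distrib := fun a b c => by
      refine Prod.ext (add_zero (0 : Fin n → k)).symm ?_
      change a.1 ⬝ᵥ θ *ᵥ (b.1 + c.1) = a.1 ⬝ᵥ θ *ᵥ b.1 + a.1 ⬝ᵥ θ *ᵥ c.1
      rw [Matrix.mulVec_add, dotProduct_add]
    right_distrib := fun a b c => by
      refine Prod.ext (add_zero (0 : Fin n → k)).symm ?_
      change (a.1 + b.1) ⬝ᵥ θ *ᵥ c.1 = a.1 ⬝ᵥ θ *ᵥ c.1 + b.1 ⬝ᵥ θ *ᵥ c.1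
      rw [add_dotProduct]
    zero_mul := fun a => by
      refine Prod.ext rfl ?_
      change (0 : Fin n → k) ⬝ᵥ θ *ᵥ a.1 = 0
      rw [zero_dotProduct]
    mul_zero := fun a => by
      refine Prod.ext rfl ?_
      change a.1 ⬝ᵥ θ *ᵥ (0 : Fin n → k) = 0
      rw [Matrix.mulVec_zero, dotProduct_zero]
    mul_assoc := fun a b c => by
      refine Prod.ext rfl ?_
      change (0 : Fin n → k) ⬝ᵥ θ *ᵥ c.1 = a.1 ⬝ᵥ θ *ᵥ (0 : Fin n → k)
      rw [zero_dotProduct, Matrix.mulVec_zero, dotProduct_zero] }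

instance : IsScalarTower k (FormAlg θ) (FormAlg θ) :=
  ⟨fun c a b => by
    refine Prod.ext (smul_zero c).symm ?_
    change (c • a.1) ⬝ᵥ θ *ᵥ b.1 = c • (a.1 ⬝ᵥ θ *ᵥ b.1)
    rw [smul_dotProduct]⟩

instance : SMulCommClass k (FormAlg θ) (FormAlg θ) :=
  ⟨fun c a b => by
    refine Prod.ext (smul_zero c) ?_
    change c • (a.1 ⬝ᵥ θ *ᵥ b.1) = a.1 ⬝ᵥ θ *ᵥ (c • b.1)
    rw [Matrix.mulVec_smul, dotProduct_smul]⟩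

/-- The basis vector `E = (0, 1)`. -/
def E (θ : Matrix (Fin n) (Fin n) k) : FormAlg θ := mk θ 0 1

/-- The basis vectors `F i = (e i, 0)` (indexed from `0`). -/
def F (θ : Matrix (Fin n) (Fin n) k) (i : Fin n) : FormAlg θ := mk θ (Pi.single i 1) 0

theorem F_mul_F (i j : Fin n) : F θ i * F θ j = θ i j • E θ := by
  refine Prod.ext (smul_zero (θ i j)).symm ?_
  change Pi.single i 1 ⬝ᵥ θ *ᵥ Pi.single j 1 = θ i j • (1 : k)
  simp

theorem E_mul (u : FormAlg θ) : E θ * u = 0 := by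
  refine Prod.ext rfl ?_
  change (0 : Fin n → k) ⬝ᵥ θ *ᵥ u.1 = 0
  rw [zero_dotProduct]

theorem mul_E (u : FormAlg θ) : u * E θ = 0 := by
  refine Prod.ext rfl ?_
  change u.1 ⬝ᵥ θ *ᵥ (0 : Fin n → k) = 0
  rw [Matrix.mulVec_zero, dotProduct_zero]

end FormAlg

section Families

variable {k : Type*} [Field k]

/-- `θ_{a,b}` on `k ^ 2`. -/
def theta2 (a b : k) : Matrix (Fin 2) (Fin 2) k :=
  !![1, a;
     b, 0]

/-- The alternating form on `k ^ 2`. -/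
def theta2Alt (k : Type*) [Field k] : Matrix (Fin 2) (Fin 2) k :=
  !![0, 1;
     -1, 0]

/-- `θ¹_{a,b}` on `k ^ 3`. -/
def theta31 (a b : k) : Matrix (Fin 3) (Fin 3) k :=
  !![1, 0, 0;
     0, 1, a;
     0, b, 0]

/-- `θ²_{a,b}` on `k ^ 3`. -/
def theta32 (a b : k) : Matrix (Fin 3) (Fin 3) k :=
  !![0, 0, 0;
     0, 1, a;
     0, b, 0]

/-- `θ³` on `k ^ 3`. -/
def theta33 (k : Type*) [Field k] : Matrix (Fin 3) (Fin 3) k :=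
  !![1, 0, 0;
     0, 0, 1;
     0, -1, 0]

/-- `θ⁴` on `k ^ 3`. -/
def theta34 (k : Type*) [Field k] : Matrix (Fin 3) (Fin 3) k :=
  !![0, 0, 0;
     0, 0, 1;
     0, -1, 0]

/-- `θ⁵` on `k ^ 3`. -/
def theta35 (k : Type*) [Field k] : Matrix (Fin 3) (Fin 3) k :=
  !![0, 1, 0;
     0, 0, 1;
     0, -1, 0]

/-- `θ⁶` on `k ^ 3`. -/
def theta36 (k : Type*) [Field k] : Matrix (Fin 3) (Fin 3) k :=
  !![1, 1, 0;
     0, 1, 1;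
     0, 1, 0]

/-- `k³_{a,b}`: `F₁F₁ = E`, `F₁F₂ = a E`, `F₂F₁ = b E`. -/
abbrev K3 (a b : k) : Type _ := FormAlg (theta2 a b)

/-- `k³_{-1}`: `F₁F₂ = -F₂F₁ = E`. -/
abbrev K3Neg (k : Type*) [Field k] : Type _ := FormAlg (theta2Alt k)

/-- `k^{4,1}_{a,b}`: `F₁F₁ = F₂F₂ = E`, `F₂F₃ = a E`, `F₃F₂ = b E`. -/
abbrev K41 (a b : k) : Type _ := FormAlg (theta31 a b)

/-- `k^{4,2}_{a,b}`: `F₂F₂ = E`, `F₂F₃ = a E`, `F₃F₂ = b E`. -/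
abbrev K42 (a b : k) : Type _ := FormAlg (theta32 a b)

/-- `k^{4,3}`: `F₁F₁ = F₂F₃ = -F₃F₂ = E`. -/
abbrev K43 (k : Type*) [Field k] : Type _ := FormAlg (theta33 k)

/-- `k^{4,4}`: `F₂F₃ = -F₃F₂ = E`. -/
abbrev K44 (k : Type*) [Field k] : Type _ := FormAlg (theta34 k)

/-- `k^{4,5}`: `F₁F₂ = F₂F₃ = -F₃F₂ = E`. -/
abbrev K45 (k : Type*) [Field k] : Type _ := FormAlg (theta35 k)

/-- `k^{4,6}`: `F₁F₁ = F₁F₂ = F₂F₂ = F₂F₃ = F₃F₂ = E`. -/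
abbrev K46 (k : Type*) [Field k] : Type _ := FormAlg (theta36 k)

end Families

end Metab

/-! If `A'` is a line `k e` and `A` is metabelian, then products of elements of `A'` vanish. Writing
`x e = c e` gives `0 = (x x) e = x (x e) = c² e`, so `e` annihilates `A` on both sides. The product
is therefore a nonzero bilinear form on a complement of `A'`, with values in `k e`, and `A` is a
`FormAlg M` (`isMetabelian_iff_algIso_formAlg`). An isomorphism of such algebras is an isometry up
to the factor by which it scales `E`; a square root absorbs that factor, so isomorphism is
congruence (`algIso_formAlg_iff`).

What remains is the classification of small bilinear forms. In rank 2, a form that is not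
alternating has a vector of nonzero square, and a quadratic equation supplies an isotropic second
vector. In rank 3, `M - Mᵀ` is alternating of odd size, hence singular, so some `v ≠ 0` satisfies `M
v = Mᵀ v`. Either `v` splits off orthogonally, which reduces to rank 2, or `v` lies in a hyperbolic
plane and an explicit basis change finishes (`hasNormalForm_of_ne_zero`).

The families are told apart by congruence invariants: the pencil `det (M + t Mᵀ)` up to a nonzero
constant, symmetry, the rank of `M + Mᵀ`, and the common kernel of `M` and `Mᵀ`. -/

namespace Metab

/-! ### Congruence of matrices and its invariants. -/

section Congruence

variable {k : Type*} [Field k] {n : ℕ} {M N R : Matrix (Fin n) (Fin n) k}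

theorem Congruent.of_det_ne_zero (C : Matrix (Fin n) (Fin n) k) (hC : C.det ≠ 0)
    (h : M = Cᵀ * N * C) : Congruent M N :=
  ⟨Matrix.GeneralLinearGroup.mkOfDetNeZero C hC, h⟩

theorem Congruent.exists_det_ne_zero (h : Congruent M N) :
    ∃ C : Matrix (Fin n) (Fin n) k, C.det ≠ 0 ∧ M = Cᵀ * N * C := by
  obtain ⟨C, h⟩ := h
  exact ⟨C, (Matrix.isUnits_det_units C).ne_zero, h⟩

theorem Congruent.symm (h : Congruent M N) : Congruent N M := by
  obtain ⟨C, rfl⟩ := h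
  refine ⟨C⁻¹, ?_⟩
  have h1 : (C : Matrix (Fin n) (Fin n) k) * ((C⁻¹ : GL (Fin n) k) : Matrix _ _ k) = 1 := by
    rw [← Units.val_mul, mul_inv_cancel, Units.val_one]
  have h2 := congrArg Matrix.transpose h1
  rw [Matrix.transpose_mul, Matrix.transpose_one] at h2
  simp only [← Matrix.mul_assoc, h2, Matrix.one_mul]
  rw [Matrix.mul_assoc, h1, Matrix.mul_one]

theorem Congruent.trans (h : Congruent M N) (h' : Congruent N R) : Congruent M R := by
  obtain ⟨C, rfl⟩ := h
  obtain ⟨D, rfl⟩ := h'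
  exact ⟨D * C, by simp [Matrix.transpose_mul, Matrix.mul_assoc]⟩

theorem Congruent.of_transform (C : Matrix (Fin n) (Fin n) k) (hC : C.det ≠ 0)
    (h : Cᵀ * M * C = N) : Congruent M N :=
  (Congruent.of_det_ne_zero C hC h.symm).symm

theorem Congruent.ne_zero (h : Congruent M N) (hN : N ≠ 0) : M ≠ 0 := by
  rintro rfl
  obtain ⟨C, h⟩ := h.symm
  exact hN (by simpa using h)

theorem Congruent.pencil (h : Congruent M N) (t : k) :
    Congruent (M + t • Mᵀ) (N + t • Nᵀ) := by
  obtain ⟨C, rfl⟩ := h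
  exact ⟨C, by simp [Matrix.transpose_mul, Matrix.mul_assoc, Matrix.mul_add, Matrix.add_mul]⟩

/-- The factor is `(det C)²`. It does not depend on `t`, so values of the pencil at different `t`
can be compared. -/
theorem Congruent.exists_det_pencil_eq (h : Congruent M N) :
    ∃ u : k, u ≠ 0 ∧ ∀ t : k, (M + t • Mᵀ).det = u * (N + t • Nᵀ).det := by
  obtain ⟨C, hC, rfl⟩ := h.exists_det_ne_zero
  refine ⟨C.det ^ 2, pow_ne_zero _ hC, fun t => ?_⟩
  have : Cᵀ * N * C + t • (Cᵀ * N * C)ᵀ = Cᵀ * (N + t • Nᵀ) * C := by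
    simp [Matrix.transpose_mul, Matrix.mul_assoc, Matrix.mul_add, Matrix.add_mul]
  rw [this, Matrix.det_mul, Matrix.det_mul, Matrix.det_transpose]
  ring

theorem Congruent.det_eq_zero_iff (h : Congruent M N) : M.det = 0 ↔ N.det = 0 := by
  obtain ⟨u, hu, h⟩ := h.exists_det_pencil_eq
  have := h 0
  simp only [zero_smul, add_zero] at this
  simp [this, hu]

theorem Congruent.eq_zero_iff (h : Congruent M N) : M = 0 ↔ N = 0 :=
  not_iff_not.1 ⟨h.symm.ne_zero, h.ne_zero⟩

theorem Congruent.add_transpose (h : Congruent M N) : Congruent (M + Mᵀ) (N + Nᵀ) := by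
  simpa using h.pencil 1

theorem Congruent.transpose_eq_iff (h : Congruent M N) : Mᵀ = M ↔ Nᵀ = N := by
  have := (h.pencil (-1)).eq_zero_iff
  simpa [← sub_eq_add_neg, sub_eq_zero, eq_comm] using this

/-- The common kernel of `M` and of its transpose is trivial. -/
def NoRadical (M : Matrix (Fin n) (Fin n) k) : Prop :=
  ∀ v : Fin n → k, M *ᵥ v = 0 → Mᵀ *ᵥ v = 0 → v = 0

theorem Congruent.noRadical (h : Congruent M N) (hN : NoRadical N) : NoRadical M := by
  obtain ⟨C, hC, rfl⟩ := h.exists_det_ne_zero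
  have inj : ∀ w, Cᵀ *ᵥ w = 0 → w = 0 := fun w hw =>
    Matrix.eq_zero_of_mulVec_eq_zero (by rwa [Matrix.det_transpose]) hw
  intro v h1 h2
  simp only [Matrix.transpose_mul, Matrix.transpose_transpose, ← Matrix.mul_assoc] at h2
  simp only [← Matrix.mulVec_mulVec] at h1 h2
  exact Matrix.eq_zero_of_mulVec_eq_zero hC (hN _ (inj _ h1) (inj _ h2))

/-- Rank at most one is preserved by congruence; it is tested here through the vanishing of 2 × 2
minors. -/
theorem Congruent.minor_eq (h : Congruent M N) {u w : Fin n → k}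
    (hN : N = Matrix.vecMulVec u w) (i j p q : Fin n) : M i j * M p q = M i q * M p j := by
  obtain ⟨C, rfl⟩ := h
  rw [hN, Matrix.mul_vecMulVec, Matrix.vecMulVec_mul]
  simp only [Matrix.vecMulVec_apply]
  ring

end Congruence

/-! ### Binary bilinear forms over an algebraically closed field. -/

section Binary

variable {k : Type*} [Field k]

theorem exists_quadratic_root [IsAlgClosed k] (b c : k) : ∃ t : k, t ^ 2 + b * t + c = 0 := by
  open Polynomial in
  have hd : (X ^ 2 + C b * X + C c : k[X]).degree = 2 := by
    have := degree_quadratic (R := k) (a := 1) (b := b) (c := c) one_ne_zero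
    simpa using this
  obtain ⟨t, ht⟩ := IsAlgClosed.exists_root (Polynomial.X ^ 2 + Polynomial.C b * Polynomial.X
    + Polynomial.C c : Polynomial k) (by rw [hd]; decide)
  exact ⟨t, by simpa [Polynomial.IsRoot] using ht⟩

theorem exists_sq_mul_eq_one [IsAlgClosed k] {a : k} (ha : a ≠ 0) :
    ∃ s : k, s ≠ 0 ∧ s ^ 2 * a = 1 := by
  obtain ⟨s, hs⟩ := IsAlgClosed.exists_pow_nat_eq (a⁻¹) (n := 2) (by norm_num)
  refine ⟨s, ?_, by rw [hs, inv_mul_cancel₀ ha]⟩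
  rintro rfl
  exact ha (by simpa using hs.symm)

/-- The new basis is `s e₁`, of square 1, and `t e₁ + e₂`, made isotropic by a root `t` of the
quadratic polynomial `M(t e₁ + e₂, t e₁ + e₂)`. -/
theorem congruent_theta2_of_apply_ne_zero [IsAlgClosed k] {a b c d : k} (ha : a ≠ 0) :
    ∃ x y : k, Congruent !![a, b; c, d] (theta2 x y) := by
  obtain ⟨s, hs, hsa⟩ := exists_sq_mul_eq_one ha
  obtain ⟨t, ht⟩ := exists_quadratic_root ((b + c) / a) (d / a)
  have ht' : a * t ^ 2 + (b + c) * t + d = 0 := by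
    field_simp at ht
    linear_combination ht
  refine ⟨s * (a * t + b), s * (a * t + c),
    Congruent.of_transform !![s, t; 0, 1] (by simpa using hs) ?_⟩
  ext i j
  fin_cases i <;> fin_cases j <;> simp [theta2, Matrix.mul_apply, Fin.sum_univ_two]
  · linear_combination hsa
  · ring
  · ring
  · linear_combination ht'

theorem congruent_theta2_or_theta2Alt [IsAlgClosed k] {M : Matrix (Fin 2) (Fin 2) k}
    (hM : M ≠ 0) : (∃ a b : k, Congruent M (theta2 a b)) ∨ Congruent M (theta2Alt k) := by
  obtain ⟨a, b, c, d, rfl⟩ : ∃ a b c d, M = !![a, b; c, d] := ⟨_, _, _, _, Matrix.eta_fin_two M⟩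
  by_cases ha : a = 0
  swap
  · exact Or.inl (congruent_theta2_of_apply_ne_zero ha)
  by_cases hd : d = 0
  swap
  · obtain ⟨x, y, h⟩ := congruent_theta2_of_apply_ne_zero (b := c) (c := b) (d := a) hd
    refine Or.inl ⟨x, y, Congruent.trans (Congruent.of_transform !![0, 1; 1, 0] (by simp) ?_) h⟩
    ext i j
    fin_cases i <;> fin_cases j <;> simp [Matrix.mul_apply, Fin.sum_univ_two]
  subst ha hd
  by_cases hbc : b + c = 0
  swap
  -- Both basis vectors are isotropic here, and `e₁ + e₂` has square `b + c`.
  · obtain ⟨x, y, h⟩ := congruent_theta2_of_apply_ne_zero (b := b) (c := c) (d := 0) hbc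
    refine Or.inl ⟨x, y, Congruent.trans (Congruent.of_transform !![1, 0; 1, 1] (by simp) ?_) h⟩
    ext i j
    fin_cases i <;> fin_cases j <;> simp [Matrix.mul_apply, Fin.sum_univ_two, add_comm]
  obtain rfl : c = -b := by linear_combination hbc
  have hb : b ≠ 0 := by
    rintro rfl
    exact hM (by ext i j; fin_cases i <;> fin_cases j <;> simp)
  refine Or.inr (Congruent.of_transform !![1, 0; 0, b⁻¹] (by simpa using hb) ?_)
  ext i j
  fin_cases i <;> fin_cases j <;> simp [theta2Alt, Matrix.mul_apply, Fin.sum_univ_two, hb]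

theorem theta2_ne_zero (a b : k) : theta2 a b ≠ 0 := fun h => by
  simpa [theta2] using congrFun (congrFun h 0) 0

theorem theta2Alt_ne_zero : theta2Alt k ≠ 0 := fun h => by
  simpa [theta2Alt] using congrFun (congrFun h 0) 1

end Binary

/-! ### Normal forms of ternary bilinear forms. -/

section Ternary

variable {k : Type*} [Field k]

/-- The orthogonal sum of the form `e x²` and of the binary form `M`. -/
def orthSum (e : k) (M : Matrix (Fin 2) (Fin 2) k) : Matrix (Fin 3) (Fin 3) k :=
  !![e, 0, 0;
     0, M 0 0, M 0 1;
     0, M 1 0, M 1 1]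

theorem orthSum_congr (e : k) {M N : Matrix (Fin 2) (Fin 2) k} (h : Congruent M N) :
    Congruent (orthSum e M) (orthSum e N) := by
  obtain ⟨C, hC, rfl⟩ := h.exists_det_ne_zero
  refine Congruent.of_det_ne_zero (orthSum 1 C) ?_ ?_
  · rw [Matrix.det_fin_two] at hC
    simpa [orthSum, Matrix.det_fin_three] using hC
  · ext i j
    fin_cases i <;> fin_cases j <;>
      simp [orthSum, Matrix.mul_apply, Fin.sum_univ_two, Fin.sum_univ_three]

theorem orthSum_one_of_ne_zero [IsAlgClosed k] {e : k} (he : e ≠ 0)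
    (M : Matrix (Fin 2) (Fin 2) k) : Congruent (orthSum e M) (orthSum 1 M) := by
  obtain ⟨s, hs, hse⟩ := exists_sq_mul_eq_one he
  refine Congruent.of_transform !![s, 0, 0; 0, 1, 0; 0, 0, 1]
    (by simpa [Matrix.det_fin_three] using hs) ?_
  ext i j
  fin_cases i <;> fin_cases j <;> simp [orthSum, Matrix.mul_apply, Fin.sum_univ_three]
  linear_combination hse

theorem theta31_eq_orthSum (a b : k) : theta31 a b = orthSum 1 (theta2 a b) := by
  simp [theta31, orthSum, theta2]

theorem theta32_eq_orthSum (a b : k) : theta32 a b = orthSum 0 (theta2 a b) := by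
  simp [theta32, orthSum, theta2]

theorem theta33_eq_orthSum : theta33 k = orthSum 1 (theta2Alt k) := by
  simp [theta33, orthSum, theta2Alt]

theorem theta34_eq_orthSum : theta34 k = orthSum 0 (theta2Alt k) := by
  simp [theta34, orthSum, theta2Alt]

theorem orthSum_one_zero_congruent : Congruent (orthSum 1 0) (theta32 (0 : k) 0) := by
  refine Congruent.of_transform !![0, 1, 0; 1, 0, 0; 0, 0, 1] (by simp [Matrix.det_fin_three]) ?_
  ext i j
  fin_cases i <;> fin_cases j <;> simp [orthSum, theta32, Matrix.mul_apply, Fin.sum_univ_three]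

/-- `M` is congruent to one of the six normal forms. -/
def HasNormalForm (M : Matrix (Fin 3) (Fin 3) k) : Prop :=
  (∃ a b : k, Congruent M (theta31 a b)) ∨ (∃ a b : k, Congruent M (theta32 a b)) ∨
    Congruent M (theta33 k) ∨ Congruent M (theta34 k) ∨ Congruent M (theta35 k) ∨
    Congruent M (theta36 k)

theorem HasNormalForm.of_congruent {M N : Matrix (Fin 3) (Fin 3) k} (h : Congruent M N)
    (hN : HasNormalForm N) : HasNormalForm M := by
  rcases hN with ⟨a, b, h'⟩ | ⟨a, b, h'⟩ | h' | h' | h' | h'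
  · exact Or.inl ⟨a, b, h.trans h'⟩
  · exact Or.inr (Or.inl ⟨a, b, h.trans h'⟩)
  · exact Or.inr (Or.inr (Or.inl (h.trans h')))
  · exact Or.inr (Or.inr (Or.inr (Or.inl (h.trans h'))))
  · exact Or.inr (Or.inr (Or.inr (Or.inr (Or.inl (h.trans h')))))
  · exact Or.inr (Or.inr (Or.inr (Or.inr (Or.inr (h.trans h')))))

theorem hasNormalForm_orthSum [IsAlgClosed k] (e : k) (M : Matrix (Fin 2) (Fin 2) k)
    (h : orthSum e M ≠ 0) : HasNormalForm (orthSum e M) := by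
  by_cases he : e = 0
  · subst he
    have hM : M ≠ 0 := by
      rintro rfl
      exact h (by ext i j; fin_cases i <;> fin_cases j <;> simp [orthSum])
    rcases congruent_theta2_or_theta2Alt hM with ⟨a, b, h'⟩ | h'
    · exact Or.inr (Or.inl ⟨a, b, theta32_eq_orthSum a b ▸ orthSum_congr 0 h'⟩)
    · exact Or.inr (Or.inr (Or.inr (Or.inl (theta34_eq_orthSum (k := k) ▸ orthSum_congr 0 h'))))
  · refine HasNormalForm.of_congruent (orthSum_one_of_ne_zero he M) ?_
    by_cases hM : M = 0
    · subst hM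
      -- The rank-one form `x²` is not of the shape `theta31`; it is the member `theta32 0 0` of the
      -- second family.
      exact Or.inr (Or.inl ⟨0, 0, orthSum_one_zero_congruent⟩)
    rcases congruent_theta2_or_theta2Alt hM with ⟨a, b, h'⟩ | h'
    · exact Or.inl ⟨a, b, theta31_eq_orthSum a b ▸ orthSum_congr 1 h'⟩
    · exact Or.inr (Or.inr (Or.inl (theta33_eq_orthSum (k := k) ▸ orthSum_congr 1 h')))

theorem exists_det_ne_zero_mulVec_single {v : Fin 3 → k} (hv : v ≠ 0) :
    ∃ C : Matrix (Fin 3) (Fin 3) k, C.det ≠ 0 ∧ C *ᵥ Pi.single 0 1 = v := by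
  by_cases h0 : v 0 = 0
  swap
  · refine ⟨!![v 0, 0, 0; v 1, 1, 0; v 2, 0, 1], by simpa [Matrix.det_fin_three] using h0, ?_⟩
    ext i
    fin_cases i <;> simp
  by_cases h1 : v 1 = 0
  swap
  · refine ⟨!![v 0, 1, 0; v 1, 0, 0; v 2, 0, 1], by simpa [Matrix.det_fin_three] using h1, ?_⟩
    ext i
    fin_cases i <;> simp
  by_cases h2 : v 2 = 0
  swap
  · refine ⟨!![v 0, 1, 0; v 1, 0, 1; v 2, 0, 0], by simpa [Matrix.det_fin_three] using h2, ?_⟩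
    ext i
    fin_cases i <;> simp
  exact absurd (by ext i; fin_cases i <;> simp [h0, h1, h2]) hv

/-- An alternating matrix of odd size is singular, so `M - Mᵀ` kills some `v ≠ 0`. Taking `v` as
first basis vector makes the first row and the first column agree. -/
theorem exists_congruent_first_row_eq_first_column (M : Matrix (Fin 3) (Fin 3) k) :
    ∃ e p q a b c d : k, Congruent M !![e, p, q; p, a, b; q, c, d] := by
  have hdet : (M - Mᵀ).det = 0 := by
    simp only [Matrix.det_fin_three, Matrix.sub_apply, Matrix.transpose_apply]
    ring
  obtain ⟨v, hv, hMv⟩ := Matrix.exists_mulVec_eq_zero_iff.2 hdet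
  rw [Matrix.sub_mulVec, sub_eq_zero] at hMv
  obtain ⟨C, hC, rfl⟩ := exists_det_ne_zero_mulVec_single hv
  obtain ⟨N, hN⟩ : ∃ N, Cᵀ * M * C = N := ⟨_, rfl⟩
  have key : N *ᵥ Pi.single 0 1 = Nᵀ *ᵥ Pi.single 0 1 := by
    simp only [← hN, Matrix.transpose_mul, Matrix.transpose_transpose, ← Matrix.mulVec_mulVec, hMv,
      Matrix.mul_assoc]
  have hrow (i : Fin 3) : N i 0 = N 0 i := by
    simpa using congrFun key i
  refine ⟨N 0 0, N 0 1, N 0 2, N 1 1, N 1 2, N 2 1, N 2 2, Congruent.of_transform C hC ?_⟩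
  rw [hN]
  conv_lhs => rw [Matrix.eta_fin_three N, hrow 1, hrow 2]

/-- The left and right orthogonal complements of the first basis vector coincide and, as `e ≠ 0`, do
not contain it. Projecting the other two basis vectors to this complement splits off `e x²`. -/
theorem hasNormalForm_of_corner_ne_zero [IsAlgClosed k] {e p q a b c d : k} (he : e ≠ 0) :
    HasNormalForm !![e, p, q; p, a, b; q, c, d] := by
  refine HasNormalForm.of_congruent (N := orthSum e !![a - p * p / e, b - p * q / e;
    c - p * q / e, d - q * q / e]) ?_ (hasNormalForm_orthSum _ _ fun h => he ?_)
  · refine Congruent.of_transform !![1, -p / e, -q / e; 0, 1, 0; 0, 0, 1]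
      (by simp [Matrix.det_fin_three]) ?_
    ext i j
    fin_cases i <;> fin_cases j <;>
      simp [orthSum, Matrix.mul_apply, Fin.sum_univ_three] <;> field_simp <;> ring
  · simpa [orthSum] using congrFun (congrFun h 0) 0

theorem hasNormalForm_of_hyperbolic [IsAlgClosed k] (h2 : (2 : k) ≠ 0) (c r : k) :
    HasNormalForm !![0, 1, 0; 1, 0, 0; 0, c, r] := by
  by_cases hc : c = 0
  · subst hc
    -- The vectors `e₁ + e₂` and `e₁ - e₂` diagonalize the hyperbolic plane.
    refine HasNormalForm.of_congruent (N := !![2, 0, 0; 0, -2, 0; 0, 0, r]) ?_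
      (hasNormalForm_of_corner_ne_zero h2)
    refine Congruent.of_transform !![1, 1, 0; 1, -1, 0; 0, 0, 1] ?_ ?_
    · simp only [Matrix.det_fin_three]
      simpa [← sub_eq_add_neg, sub_eq_zero, neg_eq_iff_add_eq_zero, one_add_one_eq_two] using h2
    · ext i j
      fin_cases i <;> fin_cases j <;> simp [Matrix.mul_apply, Fin.sum_univ_three] <;> ring
  by_cases hr : r = 0
  · subst hr
    -- The new basis is `c⁻¹ e₃`, `e₂`, `e₁ - 2 c⁻¹ e₃`; the last correction turns the pairing of
    -- the third vector with the second from `1` into `-1`.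
    refine Or.inr (Or.inr (Or.inr (Or.inr (Or.inl (Congruent.of_transform
      !![0, 0, 1; 0, 1, 0; c⁻¹, 0, -2 * c⁻¹] (by simpa [Matrix.det_fin_three] using hc) ?_)))))
    ext i j
    fin_cases i <;> fin_cases j <;>
      simp [theta35, Matrix.mul_apply, Fin.sum_univ_three, hc]
    ring
  obtain ⟨s, hs, hsr⟩ := exists_sq_mul_eq_one hr
  -- The vector `s e₃` has square 1. The coefficient `(s c)⁻¹` of `e₂` makes its pairing with the
  -- second vector 1, and the halved coefficient of `e₁` gives the second vector square 1.
  refine Or.inr (Or.inr (Or.inr (Or.inr (Or.inr (Congruent.of_transform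
    !![0, s * c / 2, s * c; 0, (s * c)⁻¹, 0; s, 0, 0] ?_ ?_)))))
  · simp [Matrix.det_fin_three, hs, hc]
  · ext i j
    fin_cases i <;> fin_cases j <;>
      simp [theta36, Matrix.mul_apply, Fin.sum_univ_three] <;> field_simp <;>
      first | ring1 | linear_combination hsr

/-- The vectors `e₁` and `e₂` span a nondegenerate plane. The second basis vector is corrected along
`e₁` to an isotropic one, which needs the division by 2. The third is made orthogonal to the first
on both sides but to the second on one side only; the entry `(c - b) / p` is the remaining
asymmetry. -/
theorem hasNormalForm_of_isotropic [IsAlgClosed k] (h2 : (2 : k) ≠ 0) {p q a b c d : k}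
    (hp : p ≠ 0) : HasNormalForm !![0, p, q; p, a, b; q, c, d] := by
  refine HasNormalForm.of_congruent (Congruent.of_transform
    (N := !![0, 1, 0; 1, 0, 0; 0, (c - b) / p, d - q / p * (b + c) + q / p * (q / p) * a])
    !![1, -a / (2 * p ^ 2), -(b - q / p * a) / p; 0, p⁻¹, -q / p; 0, 0, 1] ?_ ?_)
    (hasNormalForm_of_hyperbolic h2 _ _)
  · simpa [Matrix.det_fin_three] using hp
  · ext i j
    fin_cases i <;> fin_cases j <;>
      simp [Matrix.mul_apply, Fin.sum_univ_three] <;> field_simp <;> ring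

theorem hasNormalForm_of_ne_zero [IsAlgClosed k] (h2 : (2 : k) ≠ 0)
    {M : Matrix (Fin 3) (Fin 3) k} (hM : M ≠ 0) : HasNormalForm M := by
  obtain ⟨e, p, q, a, b, c, d, h⟩ := exists_congruent_first_row_eq_first_column M
  refine HasNormalForm.of_congruent h ?_
  have hN := h.symm.ne_zero hM
  by_cases he : e = 0
  swap
  · exact hasNormalForm_of_corner_ne_zero he
  subst he
  by_cases hp : p = 0
  swap
  · exact hasNormalForm_of_isotropic h2 hp
  subst hp
  by_cases hq : q = 0
  swap
  · refine HasNormalForm.of_congruent (Congruent.of_transform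
      (N := !![0, q, 0; q, d, c; 0, b, a]) !![1, 0, 0; 0, 0, 1; 0, 1, 0]
      (by simp [Matrix.det_fin_three]) ?_) (hasNormalForm_of_isotropic h2 hq)
    ext i j
    fin_cases i <;> fin_cases j <;> simp [Matrix.mul_apply, Fin.sum_univ_three]
  subst hq
  exact hasNormalForm_orthSum 0 !![a, b; c, d] hN

theorem theta31_ne_zero (a b : k) : theta31 a b ≠ 0 := fun h => by
  simpa [theta31] using congrFun (congrFun h 0) 0

theorem theta32_ne_zero (a b : k) : theta32 a b ≠ 0 := fun h => by
  simpa [theta32] using congrFun (congrFun h 1) 1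

theorem theta33_ne_zero : theta33 k ≠ 0 := fun h => by
  simpa [theta33] using congrFun (congrFun h 0) 0

theorem theta34_ne_zero : theta34 k ≠ 0 := fun h => by
  simpa [theta34] using congrFun (congrFun h 1) 2

theorem theta35_ne_zero : theta35 k ≠ 0 := fun h => by
  simpa [theta35] using congrFun (congrFun h 0) 1

theorem theta36_ne_zero : theta36 k ≠ 0 := fun h => by
  simpa [theta36] using congrFun (congrFun h 0) 0

theorem ne_zero_iff_congruent_fin_two [IsAlgClosed k] (M : Matrix (Fin 2) (Fin 2) k) :
    M ≠ 0 ↔ (∃ a b : k, Congruent M (theta2 a b)) ∨ Congruent M (theta2Alt k) := by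
  refine ⟨congruent_theta2_or_theta2Alt, ?_⟩
  rintro (⟨a, b, h⟩ | h)
  · exact h.ne_zero (theta2_ne_zero a b)
  · exact h.ne_zero theta2Alt_ne_zero

theorem ne_zero_iff_hasNormalForm [IsAlgClosed k] (h2 : (2 : k) ≠ 0)
    (M : Matrix (Fin 3) (Fin 3) k) : M ≠ 0 ↔ HasNormalForm M := by
  refine ⟨hasNormalForm_of_ne_zero h2, ?_⟩
  rintro (⟨a, b, h⟩ | ⟨a, b, h⟩ | h | h | h | h)
  · exact h.ne_zero (theta31_ne_zero a b)
  · exact h.ne_zero (theta32_ne_zero a b)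
  · exact h.ne_zero theta33_ne_zero
  · exact h.ne_zero theta34_ne_zero
  · exact h.ne_zero theta35_ne_zero
  · exact h.ne_zero theta36_ne_zero

end Ternary

/-! ### Isomorphisms, derived algebras and the metabelian condition. -/

section AlgIso

variable {k : Type*} [Field k] {A B D : Type*} [NonUnitalRing A] [Module k A]
  [NonUnitalRing B] [Module k B] [NonUnitalRing D] [Module k D]

theorem AlgIso.symm (h : AlgIso k A B) : AlgIso k B A := by
  obtain ⟨f, hf⟩ := h
  refine ⟨f.symm, fun x y => f.injective ?_⟩
  simp [hf]

theorem AlgIso.trans (h : AlgIso k A B) (h' : AlgIso k B D) : AlgIso k A D := by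
  obtain ⟨f, hf⟩ := h
  obtain ⟨g, hg⟩ := h'
  exact ⟨f.trans g, fun x y => by simp [hf, hg]⟩

theorem mul_mem_derivedAlg (x y : A) : x * y ∈ derivedAlg k A :=
  Submodule.subset_span ⟨x, y, rfl⟩

theorem map_derivedAlg (f : A ≃ₗ[k] B) (hf : ∀ x y, f (x * y) = f x * f y) :
    (derivedAlg k A).map (f : A →ₗ[k] B) = derivedAlg k B := by
  rw [derivedAlg, derivedAlg, Submodule.map_span]
  congr 1
  ext z
  constructor
  · rintro ⟨_, ⟨x, y, rfl⟩, rfl⟩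
    exact ⟨f x, f y, hf x y⟩
  · rintro ⟨x, y, rfl⟩
    exact ⟨f.symm x * f.symm y, ⟨_, _, rfl⟩, by simp [hf]⟩

theorem AlgIso.finrank_derivedAlg_eq (h : AlgIso k A B) :
    Module.finrank k (derivedAlg k A) = Module.finrank k (derivedAlg k B) := by
  obtain ⟨f, hf⟩ := h
  rw [← map_derivedAlg f hf]
  exact (LinearEquiv.finrank_map_eq f _).symm

/-- The extension is `0 → A' → A → A / A' → 0`. -/
theorem isMetabelian_of_mul_eq_zero
    (h : ∀ x ∈ derivedAlg k A, ∀ y ∈ derivedAlg k A, x * y = 0) : IsMetabelian k A := by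
  refine ⟨derivedAlg k A, A ⧸ derivedAlg k A, inferInstance, inferInstance, inferInstance,
    inferInstance,
    { toFun := fun x => ((show derivedAlg k A from x : derivedAlg k A) : A)
      map_smul' := fun _ _ => rfl
      map_zero' := rfl
      map_add' := fun _ _ => rfl
      map_mul' := fun x y => (h _ x.2 _ y.2).symm },
    { toFun := fun x => (derivedAlg k A).mkQ x
      map_smul' := fun c x => map_smul (derivedAlg k A).mkQ c x
      map_zero' := map_zero (derivedAlg k A).mkQ
      map_add' := fun x y => map_add (derivedAlg k A).mkQ x y
      map_mul' := fun x y => (Submodule.Quotient.mk_eq_zero _).2 (mul_mem_derivedAlg x y) },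
    Subtype.val_injective, fun x => ?_, (derivedAlg k A).mkQ_surjective⟩
  refine (Submodule.Quotient.mk_eq_zero _).trans ⟨fun hx => ⟨⟨x, hx⟩, rfl⟩, ?_⟩
  rintro ⟨y, rfl⟩
  exact y.2

/-- The quotient is abelian, so `A'` lies in the kernel of `π`, which is the image of an abelian
algebra. -/
theorem IsMetabelian.mul_eq_zero (h : IsMetabelian k A) {x y : A}
    (hx : x ∈ derivedAlg k A) (hy : y ∈ derivedAlg k A) : x * y = 0 := by
  obtain ⟨V, P, _, _, _, _, i, π, -, hex, -⟩ := h
  have key : derivedAlg k A ≤ LinearMap.ker (π : A →ₗ[k] ZeroAlg P) := by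
    refine Submodule.span_le.2 ?_
    rintro _ ⟨a, b, rfl⟩
    change π (a * b) = 0
    rw [map_mul]
    rfl
  obtain ⟨u, rfl⟩ := (hex x).1 (key hx)
  obtain ⟨v, rfl⟩ := (hex y).1 (key hy)
  rw [← map_mul, ZeroAlg.mul_eq_zero', map_zero]

end AlgIso

/-! ### The derived algebra of the algebra of a form. -/

namespace FormAlg

variable {k : Type*} [Field k] {n : ℕ} {M N : Matrix (Fin n) (Fin n) k}

theorem mul_eq_smul_E (u v : FormAlg M) : u * v = (u.1 ⬝ᵥ M *ᵥ v.1) • E M := by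
  rw [mul_def]
  refine Prod.ext (smul_zero _).symm ?_
  exact (mul_one _).symm

theorem E_ne_zero : E M ≠ 0 := fun h => one_ne_zero (α := k) (congrArg Prod.snd h)

theorem finrank_eq : Module.finrank k (FormAlg M) = n + 1 := by
  change Module.finrank k ((Fin n → k) × k) = n + 1
  simp

theorem derivedAlg_le : derivedAlg k (FormAlg M) ≤ k ∙ E M := by
  refine Submodule.span_le.2 ?_
  rintro _ ⟨x, y, rfl⟩
  rw [mul_eq_smul_E]
  exact Submodule.smul_mem _ _ (Submodule.mem_span_singleton_self _)

theorem derivedAlg_eq (hM : M ≠ 0) : derivedAlg k (FormAlg M) = k ∙ E M := by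
  refine le_antisymm derivedAlg_le ?_
  rw [Submodule.span_singleton_le_iff_mem]
  obtain ⟨i, j, hij⟩ : ∃ i j, M i j ≠ 0 := by
    by_contra! h
    exact hM (Matrix.ext h)
  have := Submodule.smul_mem (derivedAlg k (FormAlg M)) (M i j)⁻¹
    (mul_mem_derivedAlg (F M i) (F M j))
  rwa [F_mul_F, inv_smul_smul₀ hij] at this

theorem finrank_derivedAlg (hM : M ≠ 0) : Module.finrank k (derivedAlg k (FormAlg M)) = 1 := by
  rw [derivedAlg_eq hM, finrank_span_singleton E_ne_zero]

theorem derivedAlg_eq_bot (hM : M = 0) : derivedAlg k (FormAlg M) = ⊥ := by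
  refine Submodule.span_eq_bot.2 ?_
  rintro _ ⟨x, y, rfl⟩
  rw [mul_eq_smul_E, hM, Matrix.zero_mulVec, dotProduct_zero, zero_smul]

end FormAlg

/-! ### Metabelian algebras with one-dimensional derived algebra come from bilinear forms. -/

section Structure

variable {k : Type*} [Field k]

theorem AlgIso.mul_eq_zero_of_mem_derivedAlg {A : Type*} [NonUnitalRing A] [Module k A]
    {n : ℕ} {M : Matrix (Fin n) (Fin n) k}
    (h : AlgIso k A (FormAlg M)) {x : A}
    (hx : x ∈ derivedAlg k A) (y : A) : x * y = 0 := by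
  obtain ⟨f, hf⟩ := h
  have hx' : f x ∈ derivedAlg k (FormAlg M) := by
    rw [← map_derivedAlg f hf]; exact Submodule.mem_map_of_mem hx
  obtain ⟨c, hc⟩ := Submodule.mem_span_singleton.1 (FormAlg.derivedAlg_le hx')
  apply f.injective
  rw [hf, ← hc, smul_mul_assoc, FormAlg.E_mul, smul_zero, map_zero]

variable {n : ℕ} {A : Type*} [NonUnitalRing A] [Module k A]
  [IsScalarTower k A A] [SMulCommClass k A A]

theorem algIso_formAlg_of_isMetabelian (hA : Module.finrank k A = n + 1)
    (hm : IsMetabelian k A) (hd : Module.finrank k (derivedAlg k A) = 1) :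
    ∃ M : Matrix (Fin n) (Fin n) k, M ≠ 0 ∧ AlgIso k A (FormAlg M) := by
  have : FiniteDimensional k A := Module.finite_of_finrank_pos (by omega)
  obtain ⟨e, he0, he⟩ := finrank_eq_one_iff'.1 hd
  have he0' : (e : A) ≠ 0 := fun h => he0 (Subtype.ext h)
  have hmul (x y : A) : ∃ c : k, c • (e : A) = x * y := by
    obtain ⟨c, hc⟩ := he ⟨x * y, mul_mem_derivedAlg x y⟩
    exact ⟨c, congrArg Subtype.val hc⟩
  have hee (x y : A) : (x * y) * (e : A) = 0 := hm.mul_eq_zero (mul_mem_derivedAlg x y) e.2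
  have hee' (x y : A) : (e : A) * (x * y) = 0 := hm.mul_eq_zero e.2 (mul_mem_derivedAlg x y)
  have hleft (x : A) : x * (e : A) = 0 := by
    obtain ⟨c, hc⟩ := hmul x e
    have := hee x x
    -- Associativity turns `(x x) e = 0` into `c² e = 0`.
    rw [mul_assoc, ← hc, mul_smul_comm, ← hc, smul_smul, smul_eq_zero, mul_self_eq_zero] at this
    rw [← hc, this.resolve_right he0', zero_smul]
  have hright (x : A) : (e : A) * x = 0 := by
    obtain ⟨c, hc⟩ := hmul e x
    have := hee' x x
    rw [← mul_assoc, ← hc, smul_mul_assoc, ← hc, smul_smul, smul_eq_zero,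
      mul_self_eq_zero] at this
    rw [← hc, this.resolve_right he0', zero_smul]
  obtain ⟨W, hW⟩ := Submodule.exists_isCompl (derivedAlg k A)
  have hWn : Module.finrank k W = n := by
    have := Submodule.finrank_add_eq_of_isCompl hW
    omega
  let w : Module.Basis (Fin n) k W := Module.finBasisOfFinrankEq k W hWn
  choose β hβ using hmul
  let M : Matrix (Fin n) (Fin n) k := Matrix.of fun i j => β (w i) (w j)
  let g : k ≃ₗ[k] derivedAlg k A :=
    LinearEquiv.ofBijective (LinearMap.toSpanSingleton k _ e)
      ⟨fun a b hab => smul_left_injective k he0 hab, fun x => he x⟩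
  -- The `k` factor goes to `A'` and `Fin n → k` to the complement `W`.
  let f : ((Fin n → k) × k) ≃ₗ[k] A :=
    (LinearEquiv.prodComm k _ _ ≪≫ₗ LinearEquiv.prodCongr g w.equivFun.symm) ≪≫ₗ
      Submodule.prodEquivOfIsCompl _ _ hW
  have hf (u : (Fin n → k) × k) : f u = u.2 • (e : A) + ∑ i, u.1 i • (w i : A) := by
    change ((u.2 • e : derivedAlg k A) : A) + ((w.equivFun.symm u.1 : W) : A) = _
    simp [Module.Basis.equivFun_symm_apply]
  have hprod (p q : Fin n → k) (x y : k) :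
      (x • (e : A) + ∑ i, p i • (w i : A)) * (y • (e : A) + ∑ i, q i • (w i : A)) =
        (p ⬝ᵥ M *ᵥ q) • (e : A) := by
    simp only [add_mul, mul_add, hleft, hright, smul_mul_assoc, mul_smul_comm, smul_zero,
      zero_add, Finset.mul_sum, Finset.sum_mul]
    simp only [← hβ, dotProduct, Matrix.mulVec, M, Matrix.of_apply, Finset.sum_smul,
      Finset.mul_sum, smul_smul]
    simp only [Finset.smul_sum, smul_smul]
    rw [Finset.sum_comm]
    refine Finset.sum_congr rfl fun i _ => Finset.sum_congr rfl fun j _ => ?_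
    congr 1
    ring
  have hiso : AlgIso k (FormAlg M) A := by
    obtain ⟨f', hf'⟩ : ∃ f' : FormAlg M ≃ₗ[k] A, ∀ u : FormAlg M,
      f' u = u.2 • (e : A) + ∑ i, u.1 i • (w i : A) := ⟨f, hf⟩
    refine ⟨f', fun u v => ?_⟩
    rw [FormAlg.mul_def, hf', hf', hf', hprod]
    change (u.1 ⬝ᵥ M *ᵥ v.1) • (e : A) + ∑ i, (0 : k) • (w i : A) = _
    simp only [zero_smul, Finset.sum_const_zero, add_zero]
  refine ⟨M, ?_, hiso.symm⟩
  rintro hM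
  have h1 := hiso.symm.finrank_derivedAlg_eq
  rw [FormAlg.derivedAlg_eq_bot hM, finrank_bot, hd] at h1
  exact one_ne_zero h1

theorem isMetabelian_iff_algIso_formAlg :
    (Module.finrank k A = n + 1 ∧ IsMetabelian k A ∧
        Module.finrank k (derivedAlg k A) = 1) ↔
      ∃ M : Matrix (Fin n) (Fin n) k, M ≠ 0 ∧ AlgIso k A (FormAlg M) := by
  refine ⟨fun h => algIso_formAlg_of_isMetabelian h.1 h.2.1 h.2.2, ?_⟩
  rintro ⟨M, hM, h⟩
  refine ⟨?_, isMetabelian_of_mul_eq_zero fun x hx y _ => h.mul_eq_zero_of_mem_derivedAlg hx y,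
    by rw [h.finrank_derivedAlg_eq, FormAlg.finrank_derivedAlg hM]⟩
  obtain ⟨f, -⟩ := h
  rw [f.finrank_eq, FormAlg.finrank_eq]

end Structure

/-! ### Isomorphism of form algebras is congruence of forms. -/

section Iso

variable {k : Type*} [Field k] {n : ℕ} {M N : Matrix (Fin n) (Fin n) k}

theorem Congruent.algIso (h : Congruent M N) : AlgIso k (FormAlg M) (FormAlg N) := by
  obtain ⟨C, rfl⟩ := h
  have h1 : (C : Matrix (Fin n) (Fin n) k) * ((C⁻¹ : GL (Fin n) k) : Matrix (Fin n) (Fin n) k) = 1 := by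
    rw [← Units.val_mul, mul_inv_cancel, Units.val_one]
  have h2 : ((C⁻¹ : GL (Fin n) k) : Matrix (Fin n) (Fin n) k) * (C : Matrix (Fin n) (Fin n) k) = 1 := by
    rw [← Units.val_mul, inv_mul_cancel, Units.val_one]
  let g : (Fin n → k) ≃ₗ[k] (Fin n → k) := Matrix.toLin'OfInv h2 h1
  have hg (p : Fin n → k) : g p = (C : Matrix (Fin n) (Fin n) k) *ᵥ p := Matrix.toLin'_apply _ p
  refine ⟨LinearEquiv.prodCongr g (LinearEquiv.refl k k), fun u v => ?_⟩
  refine Prod.ext (map_zero g) ?_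
  change u.1 ⬝ᵥ ((C : Matrix (Fin n) (Fin n) k)ᵀ * N * (C : Matrix (Fin n) (Fin n) k)) *ᵥ v.1 =
    g u.1 ⬝ᵥ N *ᵥ g v.1
  rw [hg, hg, ← Matrix.mulVec_mulVec, ← Matrix.mulVec_mulVec, Matrix.dotProduct_mulVec,
    Matrix.vecMul_transpose]

theorem eq_zero_of_algIso_zero (h : AlgIso k (FormAlg M) (FormAlg N)) (hM : M = 0) : N = 0 := by
  by_contra hN
  have := h.finrank_derivedAlg_eq
  rw [FormAlg.finrank_derivedAlg hN] at this
  rw [FormAlg.derivedAlg_eq_bot hM, finrank_bot] at this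
  exact zero_ne_one this

theorem AlgIso.congruent [IsAlgClosed k] (h : AlgIso k (FormAlg M) (FormAlg N)) :
    Congruent M N := by
  by_cases hM : M = 0
  -- For `M = 0` the derived algebra is zero and does not single out the line of `E`, so this case
  -- is separate.
  · rw [hM, eq_zero_of_algIso_zero h hM]
    exact ⟨1, by simp⟩
  obtain ⟨f, hf⟩ := h
  obtain ⟨c, hc⟩ : ∃ c : k, c • FormAlg.E N = f (FormAlg.E M) := by
    refine Submodule.mem_span_singleton.1 (FormAlg.derivedAlg_le ?_)
    rw [← map_derivedAlg f hf, FormAlg.derivedAlg_eq hM]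
    exact Submodule.mem_map_of_mem (Submodule.mem_span_singleton_self _)
  have hc0 : c ≠ 0 := by
    rintro rfl
    rw [zero_smul] at hc
    exact FormAlg.E_ne_zero (f.injective (hc.symm.trans (map_zero f).symm))
  -- The map `f` need not preserve `k ^ n × 0`, but products ignore the second coordinate, so only
  -- the first component of `f` matters.
  let φ : (Fin n → k) →ₗ[k] (Fin n → k) :=
    (LinearMap.fst k (Fin n → k) k) ∘ₗ (show ((Fin n → k) × k) →ₗ[k] ((Fin n → k) × k) from
      (f : FormAlg M →ₗ[k] FormAlg N)) ∘ₗ (LinearMap.inl k (Fin n → k) k)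
  have hφ (p : Fin n → k) : φ p = (f (FormAlg.mk M p 0)).1 := rfl
  have hinj : ∀ p, φ p = 0 → p = 0 := by
    intro p hp
    rw [hφ] at hp
    -- If `φ p = 0`, then `f (p, 0)` lies on the line of `E N`, which is the image of the line of `E
    -- M`.
    have h1 : f (FormAlg.mk M p 0) = f (((f (FormAlg.mk M p 0)).2 * c⁻¹) • FormAlg.E M) := by
      rw [map_smul, ← hc, smul_smul, inv_mul_cancel_right₀ hc0]
      refine Prod.ext (hp.trans (smul_zero _).symm) (mul_one _).symm
    have h2 := congrArg Prod.fst (f.injective h1)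
    exact h2.trans (smul_zero _)
  have hform (p q : Fin n → k) : (p ⬝ᵥ M *ᵥ q) * c = φ p ⬝ᵥ N *ᵥ φ q := by
    have := hf (FormAlg.mk M p 0) (FormAlg.mk M q 0)
    rw [FormAlg.mul_eq_smul_E, map_smul, ← hc] at this
    have h2 := congrArg Prod.snd this
    refine Eq.trans ?_ h2
    change _ = (p ⬝ᵥ M *ᵥ q) * (c * 1)
    rw [mul_one]
  -- The map `φ` multiplies the form by `c`; rescaling it by a square root of `c⁻¹` gives an
  -- isometry.
  obtain ⟨s, hs⟩ := IsAlgClosed.exists_pow_nat_eq (c⁻¹) (n := 2) (by norm_num)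
  have hs0 : s ≠ 0 := by
    rintro rfl
    exact inv_ne_zero hc0 (by simpa using hs.symm)
  have hdet : (s • LinearMap.toMatrix' φ).det ≠ 0 := by
    rw [Matrix.det_smul]
    refine mul_ne_zero (pow_ne_zero _ hs0) fun h0 => ?_
    obtain ⟨v, hv, hv0⟩ := Matrix.exists_mulVec_eq_zero_iff.2 h0
    exact hv (hinj v (by rwa [LinearMap.toMatrix'_mulVec] at hv0))
  refine ⟨Matrix.GeneralLinearGroup.mkOfDetNeZero _ hdet, ?_⟩
  change M = (s • LinearMap.toMatrix' φ)ᵀ * N * (s • LinearMap.toMatrix' φ)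
  ext i j
  have h1 := hform (Pi.single i 1) (Pi.single j 1)
  rw [← LinearMap.toMatrix'_mulVec φ, ← LinearMap.toMatrix'_mulVec φ,
    ← Matrix.vecMul_transpose (LinearMap.toMatrix' φ), ← Matrix.dotProduct_mulVec, Matrix.mulVec_mulVec, Matrix.mulVec_mulVec] at h1
  simp only [single_one_dotProduct, Matrix.mulVec_single_one, Matrix.col_apply] at h1
  simp only [Matrix.transpose_smul, Matrix.smul_mul, Matrix.mul_smul, Matrix.smul_apply,
    smul_eq_mul]
  rw [← h1]
  have : s * s * c = 1 := by rw [← sq, hs, inv_mul_cancel₀ hc0]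
  linear_combination (-M i j) * this

theorem algIso_formAlg_iff [IsAlgClosed k] :
    AlgIso k (FormAlg M) (FormAlg N) ↔ Congruent M N :=
  ⟨AlgIso.congruent, Congruent.algIso⟩

end Iso

/-! ### Separating the normal forms. -/

section Families

variable {k : Type*} [Field k]

theorem det_theta31_pencil (a b t : k) : (theta31 a b + t • (theta31 a b)ᵀ).det =
    -((1 + t) * (a + t * b) * (b + t * a)) := by
  simp [theta31, Matrix.det_fin_three]

theorem det_theta32 (a b : k) : (theta32 a b).det = 0 := by
  simp [theta32, Matrix.det_fin_three]

theorem det_theta33 : (theta33 k).det = 1 := by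
  simp [theta33, Matrix.det_fin_three]

theorem det_theta34 : (theta34 k).det = 0 := by
  simp [theta34, Matrix.det_fin_three]

theorem det_theta35_pencil_zero : (theta35 k + (0 : k) • (theta35 k)ᵀ).det = 0 := by
  simp [theta35, Matrix.det_fin_three]

theorem det_theta35_pencil_one : (theta35 k + (1 : k) • (theta35 k)ᵀ).det = 0 := by
  simp [theta35, Matrix.det_fin_three]

theorem det_theta35 : (theta35 k).det = 0 := by
  simp [theta35, Matrix.det_fin_three]

theorem det_theta36_pencil (t : k) : (theta36 k + t • (theta36 k)ᵀ).det = -(1 + t) ^ 3 := by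
  simp [theta36, Matrix.det_fin_three]
  ring

theorem det_theta36 : (theta36 k).det = -1 := by
  simp [theta36, Matrix.det_fin_three]

theorem theta33_add_transpose :
    theta33 k + (theta33 k)ᵀ = Matrix.vecMulVec ![2, 0, 0] ![1, 0, 0] := by
  ext i j
  fin_cases i <;> fin_cases j <;> simp [theta33, Matrix.vecMulVec_apply, one_add_one_eq_two]

theorem theta34_add_transpose : theta34 k + (theta34 k)ᵀ = 0 := by
  ext i j
  fin_cases i <;> fin_cases j <;> simp [theta34]

theorem theta2Alt_add_transpose : theta2Alt k + (theta2Alt k)ᵀ = 0 := by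
  ext i j
  fin_cases i <;> fin_cases j <;> simp [theta2Alt]

theorem theta32_zero_zero :
    theta32 (0 : k) 0 = Matrix.vecMulVec ![0, 1, 0] ![0, 1, 0] := by
  ext i j
  fin_cases i <;> fin_cases j <;> simp [theta32, Matrix.vecMulVec_apply]

theorem transpose_theta31_eq_iff (a b : k) : (theta31 a b)ᵀ = theta31 a b ↔ a = b := by
  refine ⟨fun h => by simpa [theta31] using congrFun (congrFun h 2) 1, ?_⟩
  rintro rfl
  ext i j
  fin_cases i <;> fin_cases j <;> simp [theta31]

theorem transpose_theta32_eq_iff (a b : k) : (theta32 a b)ᵀ = theta32 a b ↔ a = b := by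
  refine ⟨fun h => by simpa [theta32] using congrFun (congrFun h 2) 1, ?_⟩
  rintro rfl
  ext i j
  fin_cases i <;> fin_cases j <;> simp [theta32]

theorem transpose_theta35_ne : (theta35 k)ᵀ ≠ theta35 k := fun h => by
  simpa [theta35] using congrFun (congrFun h 0) 1

theorem transpose_theta36_ne : (theta36 k)ᵀ ≠ theta36 k := fun h => by
  simpa [theta36] using congrFun (congrFun h 0) 1

theorem not_noRadical_theta32 (a b : k) : ¬ NoRadical (theta32 a b) := by
  intro h
  have := h ![1, 0, 0] (by ext i; fin_cases i <;> simp [theta32])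
    (by ext i; fin_cases i <;> simp [theta32, Matrix.mulVec, dotProduct, Fin.sum_univ_three])
  simpa using congrFun this 0

theorem noRadical_theta35 : NoRadical (theta35 k) := by
  intro v h1 h2
  have e1 := congrFun h1 0
  have e2 := congrFun h1 1
  have e3 := congrFun h2 1
  simp [theta35, Matrix.mulVec, dotProduct, Fin.sum_univ_three] at e1 e2 e3
  ext i
  fin_cases i <;> simp [e1, e2]
  simpa [e2] using e3

theorem noRadical_theta31 {a b : k} (hab : a ≠ 0 ∨ b ≠ 0) : NoRadical (theta31 a b) := by
  intro v h1 h2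
  have e1 := congrFun h1 0
  have e2 := congrFun h1 1
  have e3 := congrFun h1 2
  have e4 := congrFun h2 1
  have e5 := congrFun h2 2
  simp [theta31, Matrix.mulVec, dotProduct, Fin.sum_univ_three] at e1 e2 e3 e4 e5
  have hv1 : v 1 = 0 := by
    rcases hab with h | h
    · exact e5.resolve_left h
    · exact e3.resolve_left h
  rw [hv1] at e2 e4
  have hv2 : v 2 = 0 := by
    rcases hab with h | h
    · simpa [h] using e2
    · simpa [h] using e4
  ext i
  fin_cases i <;> simp [e1, hv1, hv2]

theorem add_transpose_eq_zero_of_congruent {n : ℕ} {M N : Matrix (Fin n) (Fin n) k}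
    (h : Congruent M N) (hN : N + Nᵀ = 0) : M + Mᵀ = 0 :=
  h.add_transpose.eq_zero_iff.2 hN

theorem not_congruent_theta2_theta2Alt (h2 : (2 : k) ≠ 0) (a b : k) :
    ¬ Congruent (theta2 a b) (theta2Alt k) := fun h => h2 <| by
  simpa [theta2, one_add_one_eq_two] using congrFun (congrFun
    (add_transpose_eq_zero_of_congruent h theta2Alt_add_transpose) 0) 0

theorem not_congruent_theta31_theta33 (h2 : (2 : k) ≠ 0) (a b : k) :
    ¬ Congruent (theta31 a b) (theta33 k) := fun h => h2 <| by
  simpa [theta31, one_add_one_eq_two] using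
    h.add_transpose.minor_eq theta33_add_transpose 0 0 1 1

theorem not_congruent_theta31_theta34 (h2 : (2 : k) ≠ 0) (a b : k) :
    ¬ Congruent (theta31 a b) (theta34 k) := fun h => h2 <| by
  simpa [theta31, one_add_one_eq_two] using congrFun (congrFun
    (add_transpose_eq_zero_of_congruent h theta34_add_transpose) 0) 0

/-- The pencil of `theta35` vanishes at `t = 0` and `t = 1`, which gives `a b = 0` and `(a + b)² =
0`. Then `a = b = 0` and `theta31 a b` is symmetric, unlike `theta35`. -/
theorem not_congruent_theta31_theta35 (h2 : (2 : k) ≠ 0) (a b : k) :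
    ¬ Congruent (theta31 a b) (theta35 k) := by
  intro h
  obtain ⟨u, -, hu⟩ := h.exists_det_pencil_eq
  have e0 := hu 0
  have e1 := hu 1
  rw [det_theta31_pencil, det_theta35_pencil_zero] at e0
  rw [det_theta31_pencil, det_theta35_pencil_one] at e1
  have hs : a + b = 0 := by
    have : 2 * (a + b) ^ 2 = 0 := by linear_combination -e1
    simpa [h2] using this
  have ha : a = 0 := by
    have : a ^ 2 = 0 := by linear_combination e0 + a * hs
    simpa using this
  have hb : a = b := by linear_combination 2 * ha - hs
  exact transpose_theta35_ne (h.transpose_eq_iff.1 ((transpose_theta31_eq_iff a b).2 hb))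

/-- Comparing the pencils at `t = 0` and `t = 1` gives `a b = u` and `2 (a + b)² = 8 u`, hence `(a -
b)² = 0`. Then `theta31 a b` is symmetric, unlike `theta36`. -/
theorem not_congruent_theta31_theta36 (h2 : (2 : k) ≠ 0) (a b : k) :
    ¬ Congruent (theta31 a b) (theta36 k) := by
  intro h
  obtain ⟨u, -, hu⟩ := h.exists_det_pencil_eq
  have e0 := hu 0
  have e1 := hu 1
  rw [det_theta31_pencil, det_theta36_pencil] at e0 e1
  have hs : a = b := by
    have : 2 * (a - b) ^ 2 = 0 := by linear_combination 8 * e0 - e1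
    have : a - b = 0 := by simpa [h2] using this
    exact sub_eq_zero.1 this
  exact transpose_theta36_ne (h.transpose_eq_iff.1 ((transpose_theta31_eq_iff a b).2 hs))

theorem not_congruent_theta32_theta33 (a b : k) : ¬ Congruent (theta32 a b) (theta33 k) :=
  fun h => one_ne_zero (det_theta33.symm.trans (h.det_eq_zero_iff.1 (det_theta32 a b)))

theorem not_congruent_theta32_theta34 (h2 : (2 : k) ≠ 0) (a b : k) :
    ¬ Congruent (theta32 a b) (theta34 k) := fun h => h2 <| by
  simpa [theta32, one_add_one_eq_two] using congrFun (congrFun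
    (add_transpose_eq_zero_of_congruent h theta34_add_transpose) 1) 1

theorem not_congruent_theta32_theta35 (a b : k) : ¬ Congruent (theta32 a b) (theta35 k) :=
  fun h => not_noRadical_theta32 a b (h.noRadical noRadical_theta35)

theorem theta36_det_ne_zero : (theta36 k).det ≠ 0 := by
  rw [det_theta36]
  exact neg_ne_zero.2 one_ne_zero

theorem not_congruent_theta32_theta36 (a b : k) : ¬ Congruent (theta32 a b) (theta36 k) :=
  fun h => theta36_det_ne_zero (h.det_eq_zero_iff.1 (det_theta32 a b))

theorem theta33_det_ne_zero : (theta33 k).det ≠ 0 := by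
  rw [det_theta33]
  exact one_ne_zero

theorem not_congruent_theta33_theta34 : ¬ Congruent (theta33 k) (theta34 k) :=
  fun h => theta33_det_ne_zero (h.det_eq_zero_iff.2 det_theta34)

theorem not_congruent_theta33_theta35 : ¬ Congruent (theta33 k) (theta35 k) :=
  fun h => theta33_det_ne_zero (h.det_eq_zero_iff.2 det_theta35)

theorem not_congruent_theta33_theta36 (h2 : (2 : k) ≠ 0) :
    ¬ Congruent (theta33 k) (theta36 k) := fun h => h2 <| by
  simpa [theta36, one_add_one_eq_two] using
    h.symm.add_transpose.minor_eq theta33_add_transpose 0 1 1 2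

theorem not_congruent_theta34_theta35 : ¬ Congruent (theta34 k) (theta35 k) := by
  intro h
  have := congrFun (congrFun
    (add_transpose_eq_zero_of_congruent h.symm theta34_add_transpose) 0) 1
  simp [theta35] at this

theorem not_congruent_theta34_theta36 : ¬ Congruent (theta34 k) (theta36 k) :=
  fun h => theta36_det_ne_zero (h.det_eq_zero_iff.1 det_theta34)

theorem not_congruent_theta35_theta36 : ¬ Congruent (theta35 k) (theta36 k) :=
  fun h => theta36_det_ne_zero (h.det_eq_zero_iff.1 det_theta35)

/-- Every `theta32 c d` has a radical, which forces `a = b = 0`; then symmetry gives `c = d` and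
rank two gives `c ≠ 0`. Conversely `y² + 2 c y z = (y + c z)² - (c z)²`, and a square root of `-1`
makes this a sum of two squares. -/
theorem congruent_theta31_theta32_iff [IsAlgClosed k] (a b c d : k) :
    Congruent (theta31 a b) (theta32 c d) ↔ a = 0 ∧ b = 0 ∧ c = d ∧ c ≠ 0 := by
  constructor
  · intro h
    have hab : ¬ (a ≠ 0 ∨ b ≠ 0) := fun hab =>
      not_noRadical_theta32 c d (h.symm.noRadical (noRadical_theta31 hab))
    push Not at hab
    obtain ⟨rfl, rfl⟩ := hab
    obtain rfl : c = d := (transpose_theta32_eq_iff c d).1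
      (h.transpose_eq_iff.1 ((transpose_theta31_eq_iff _ _).2 rfl))
    refine ⟨rfl, rfl, rfl, ?_⟩
    rintro rfl
    have := h.minor_eq theta32_zero_zero 0 0 1 1
    simp [theta31] at this
  · rintro ⟨rfl, rfl, rfl, hc⟩
    obtain ⟨s, hs⟩ := IsAlgClosed.exists_pow_nat_eq (-1 : k) (n := 2) (by norm_num)
    have hs0 : s ≠ 0 := by
      rintro rfl
      simp at hs
    refine (Congruent.of_transform !![0, 0, 1; 1, s, 0; 0, -s / c, 0] ?_ ?_).symm
    · simp [Matrix.det_fin_three, hs0, hc]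
    · ext i j
      fin_cases i <;> fin_cases j <;>
        simp [theta31, theta32, Matrix.mul_apply, Fin.sum_univ_three] <;> field_simp <;>
        first | ring1 | linear_combination -hs

end Families

/-! ### The lists in dimensions three and four. -/

section Lists

variable {k : Type*} [Field k] [IsAlgClosed k] {A : Type*} [NonUnitalRing A] [Module k A]

theorem AlgIso.formAlg_congr_iff {n : ℕ} {M N : Matrix (Fin n) (Fin n) k}
    (h : AlgIso k A (FormAlg M)) : AlgIso k A (FormAlg N) ↔ Congruent M N :=
  ⟨fun h' => (h.symm.trans h').congruent, fun h' => h.trans h'.algIso⟩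

variable [IsScalarTower k A A] [SMulCommClass k A A]

theorem isMetabelian_dim_three_iff :
    (Module.finrank k A = 3 ∧ IsMetabelian k A ∧ Module.finrank k (derivedAlg k A) = 1) ↔
      ((∃ a b : k, AlgIso k A (K3 a b)) ∨ AlgIso k A (K3Neg k)) := by
  rw [isMetabelian_iff_algIso_formAlg (n := 2)]
  constructor
  · rintro ⟨M, hM, h⟩
    simpa only [h.formAlg_congr_iff] using (ne_zero_iff_congruent_fin_two M).1 hM
  · rintro (⟨a, b, h⟩ | h)
    · exact ⟨_, theta2_ne_zero a b, h⟩
    · exact ⟨_, theta2Alt_ne_zero, h⟩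

theorem isMetabelian_dim_four_iff (h2 : (2 : k) ≠ 0) :
    (Module.finrank k A = 4 ∧ IsMetabelian k A ∧ Module.finrank k (derivedAlg k A) = 1) ↔
      ((∃ a b : k, AlgIso k A (K41 a b)) ∨ (∃ a b : k, AlgIso k A (K42 a b)) ∨
        AlgIso k A (K43 k) ∨ AlgIso k A (K44 k) ∨ AlgIso k A (K45 k) ∨ AlgIso k A (K46 k)) := by
  rw [isMetabelian_iff_algIso_formAlg (n := 3)]
  constructor
  · rintro ⟨M, hM, h⟩
    simpa only [h.formAlg_congr_iff, HasNormalForm] using (ne_zero_iff_hasNormalForm h2 M).1 hM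
  · rintro (⟨a, b, h⟩ | ⟨a, b, h⟩ | h | h | h | h)
    · exact ⟨_, theta31_ne_zero a b, h⟩
    · exact ⟨_, theta32_ne_zero a b, h⟩
    · exact ⟨_, theta33_ne_zero, h⟩
    · exact ⟨_, theta34_ne_zero, h⟩
    · exact ⟨_, theta35_ne_zero, h⟩
    · exact ⟨_, theta36_ne_zero, h⟩

end Lists

end Metab

theorem mainTheorem5 (k : Type*) [Field k] [IsAlgClosed k] (hchar : ringChar k ≠ 2) :
    -- dimension 3: the list is complete, and its two families are disjoint
    (∀ (A : Type*) [NonUnitalRing A] [Module k A] [IsScalarTower k A A] [SMulCommClass k A A],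
      (Module.finrank k A = 3 ∧ Metab.IsMetabelian k A ∧
          Module.finrank k (Metab.derivedAlg k A) = 1) ↔
        ((∃ a b : k, Metab.AlgIso k A (Metab.K3 a b)) ∨ Metab.AlgIso k A (Metab.K3Neg k))) ∧
    (∀ a b : k, ¬ Metab.AlgIso k (Metab.K3 a b) (Metab.K3Neg k)) ∧
    -- dimension 4: the list is complete
    (∀ (A : Type*) [NonUnitalRing A] [Module k A] [IsScalarTower k A A] [SMulCommClass k A A],
      (Module.finrank k A = 4 ∧ Metab.IsMetabelian k A ∧
          Module.finrank k (Metab.derivedAlg k A) = 1) ↔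
        ((∃ a b : k, Metab.AlgIso k A (Metab.K41 a b)) ∨
          (∃ a b : k, Metab.AlgIso k A (Metab.K42 a b)) ∨
          Metab.AlgIso k A (Metab.K43 k) ∨ Metab.AlgIso k A (Metab.K44 k) ∨
          Metab.AlgIso k A (Metab.K45 k) ∨ Metab.AlgIso k A (Metab.K46 k))) ∧
    -- dimension 4: overlaps between different families
    (∀ a b c d : k, Metab.AlgIso k (Metab.K41 a b) (Metab.K42 c d) ↔
      (a = 0 ∧ b = 0 ∧ c = d ∧ c ≠ 0)) ∧
    (∀ a b : k,
      ¬ Metab.AlgIso k (Metab.K41 a b) (Metab.K43 k) ∧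
      ¬ Metab.AlgIso k (Metab.K41 a b) (Metab.K44 k) ∧
      ¬ Metab.AlgIso k (Metab.K41 a b) (Metab.K45 k) ∧
      ¬ Metab.AlgIso k (Metab.K41 a b) (Metab.K46 k)) ∧
    (∀ a b : k,
      ¬ Metab.AlgIso k (Metab.K42 a b) (Metab.K43 k) ∧
      ¬ Metab.AlgIso k (Metab.K42 a b) (Metab.K44 k) ∧
      ¬ Metab.AlgIso k (Metab.K42 a b) (Metab.K45 k) ∧
      ¬ Metab.AlgIso k (Metab.K42 a b) (Metab.K46 k)) ∧
    (¬ Metab.AlgIso k (Metab.K43 k) (Metab.K44 k) ∧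
      ¬ Metab.AlgIso k (Metab.K43 k) (Metab.K45 k) ∧
      ¬ Metab.AlgIso k (Metab.K43 k) (Metab.K46 k) ∧
      ¬ Metab.AlgIso k (Metab.K44 k) (Metab.K45 k) ∧
      ¬ Metab.AlgIso k (Metab.K44 k) (Metab.K46 k) ∧
      ¬ Metab.AlgIso k (Metab.K45 k) (Metab.K46 k)) ∧
    -- the correspondence with bilinear forms up to congruence
    (∀ (n : ℕ) (M N : Matrix (Fin n) (Fin n) k),
      Metab.AlgIso k (Metab.FormAlg M) (Metab.FormAlg N) ↔ Metab.Congruent M N) ∧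
    (∀ M : Matrix (Fin 2) (Fin 2) k, M ≠ 0 ↔
      ((∃ a b : k, Metab.Congruent M (Metab.theta2 a b)) ∨
        Metab.Congruent M (Metab.theta2Alt k))) ∧
    (∀ M : Matrix (Fin 3) (Fin 3) k, M ≠ 0 ↔
      ((∃ a b : k, Metab.Congruent M (Metab.theta31 a b)) ∨
        (∃ a b : k, Metab.Congruent M (Metab.theta32 a b)) ∨
        Metab.Congruent M (Metab.theta33 k) ∨ Metab.Congruent M (Metab.theta34 k) ∨
        Metab.Congruent M (Metab.theta35 k) ∨ Metab.Congruent M (Metab.theta36 k))) := by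
  have h2 : (2 : k) ≠ 0 := Ring.two_ne_zero hchar
  open Metab in
  exact ⟨fun A => isMetabelian_dim_three_iff,
    fun a b h => not_congruent_theta2_theta2Alt h2 a b h.congruent,
    fun A => isMetabelian_dim_four_iff h2,
    fun a b c d => algIso_formAlg_iff.trans (congruent_theta31_theta32_iff a b c d),
    fun a b => ⟨fun h => not_congruent_theta31_theta33 h2 a b h.congruent,
      fun h => not_congruent_theta31_theta34 h2 a b h.congruent,
      fun h => not_congruent_theta31_theta35 h2 a b h.congruent,
      fun h => not_congruent_theta31_theta36 h2 a b h.congruent⟩,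
    fun a b => ⟨fun h => not_congruent_theta32_theta33 a b h.congruent,
      fun h => not_congruent_theta32_theta34 h2 a b h.congruent,
      fun h => not_congruent_theta32_theta35 a b h.congruent,
      fun h => not_congruent_theta32_theta36 a b h.congruent⟩,
    ⟨fun h => not_congruent_theta33_theta34 h.congruent,
      fun h => not_congruent_theta33_theta35 h.congruent,
      fun h => not_congruent_theta33_theta36 h2 h.congruent,
      fun h => not_congruent_theta34_theta35 h.congruent,
      fun h => not_congruent_theta34_theta36 h.congruent,
      fun h => not_congruent_theta35_theta36 h.congruent⟩,
    fun n M N => algIso_formAlg_iff,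
    fun M => ne_zero_iff_congruent_fin_two M,
    fun M => ne_zero_iff_hasNormalForm h2 M⟩
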